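/- Let $\mathcal U$ and $\mathcal V$ be finite alphabets, let $Q_{V|U}$ be a channel from $\mathcal U$ to $\mathcal V$, and let $Q_V$ be a probability distribution on $\mathcal V$ (the target). For a rate $R\in\mathbb R$ and a block length $n\ge 1$ put $M=\lfloor 2^{nR}\rfloor$. Let $W$ be uniformly distributed on $\{1,\dots,M\}$ (this requires $M\ge 1$), let $f:\{1,\dots,M\}\to\mathcal U^n$ be an encoder, and let $V^n$ be the output of the memoryless channel $Q^n_{V|U}$ with input $U^n=f(W)$, so that $$P_{V^n}(v^n)=\sum_{w=1}^M \frac1M\prod_{i=1}^n Q_{V|U}\big(v_i\,|\,f(w)_i\big).$$ Let $Q_V^n(v^n)=\prod_{i=1}^n Q_V(v_i)$ and let $$D(P_{V^n}\|Q_V^n)=\sum_{v^n\in\mathrm{supp}(P_{V^n})}P_{V^n}(v^n)\log_2\frac{P_{V^n}(v^n)}{Q_V^n(v^n)}$$ be the unnormalized informational divergence, which is $+\infty$ if $\mathrm{supp}(P_{V^n})\not\subseteq\mathrm{supp}(Q_V^n)$. The rate $R$ is called achievable if for every $\xi>0$ there are an $n\ge1$ with $M\ge 1$ and an encoder $f$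 with $D(P_{V^n}\|Q_V^n)<\xi$. Let $\mathcal Q$ be the set of joint probability distributions $Q_{UV}$ on $\mathcal U\times\mathcal V$ of the form $Q_{UV}(u,v)=Q_U(u)\,Q_{V|U}(v|u)$ that have $V$-marginal $Q_V$ and satisfy $|\mathrm{supp}(Q_U)|\le|\mathcal V|$, and let $I(V;U)$ be the mutual information, in bits, calculated with $Q_{UV}$. **Theorem.** (1) If $R>I(V;U)$ for some $Q_{UV}\in\mathcal Q$, then $R$ is achievable; moreover, for every $\xi>0$ and every sufficiently large $n$ there is an encoder with $D(P_{V^n}\|Q_V^n)<\xi$. (2) If $R<I(V;U)$ for every $Q_{UV}\in\mathcal Q$, then $R$ is not achievable. -/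

import Mathlib

namespace ProductApprox

noncomputable section

open scoped BigOperators

/-- Informational divergence `D(P‖Q)` in bits of two distributions on a finite set, with values in
the extended reals: it is `+∞` unless the support of `P` is contained in that of `Q`.
(Terms with `P a = 0` contribute `0`.) -/
def divergence {α : Type*} [Fintype α] (P Q : α → ℝ) : EReal :=
  open Classical in
  if ∀ a, Q a = 0 → P a = 0 then ((∑ a, P a * Real.logb 2 (P a / Q a) : ℝ) : EReal) else ⊤

/-- The `U`-marginal of a joint distribution. -/
def marginalU {U V : Type*} [Fintype V] (Q : U × V → ℝ) : U → ℝ := fun u => ∑ v, Q (u, v)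

/-- The `V`-marginal of a joint distribution. -/
def marginalV {U V : Type*} [Fintype U] (Q : U × V → ℝ) : V → ℝ := fun v => ∑ u, Q (u, v)

/-- Mutual information `I(V;U)` in bits of a joint distribution on a finite product.
(Terms with `Q (u, v) = 0` contribute `0`.) -/
def mutualInfo {U V : Type*} [Fintype U] [Fintype V] (Q : U × V → ℝ) : ℝ :=
  ∑ u, ∑ v, Q (u, v) * Real.logb 2 (Q (u, v) / (marginalU Q u * marginalV Q v))

/-- `W` is a channel: `W u` is the output distribution `Q_{V|U}(· | u)`. -/
def IsChannel {U V : Type*} [Fintype V] (W : U → V → ℝ) : Prop :=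
  ∀ u, W u ∈ stdSimplex ℝ V

/-- The joint distributions `Q_{UV}` over which the mutual information is taken: probability
distributions with `V`-marginal `QV`, with conditional distribution of `V` given `U` equal to the
channel `W`, and with at most `|V|` symbols `u` of positive probability. -/
structure IsAdmissibleJoint {U V : Type*} [Fintype U] [Fintype V]
    (W : U → V → ℝ) (QV : V → ℝ) (Q : U × V → ℝ) : Prop where
  mem_stdSimplex : Q ∈ stdSimplex ℝ (U × V)
  marginalV_eq : marginalV Q = QV
  eq_mul_channel : ∀ u v, Q (u, v) = marginalU Q u * W u v
  card_support_le : (Function.support (marginalU Q)).ncard ≤ Fintype.card V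

/-- The product distribution `Q_V^n`. -/
def prodDist {V : Type*} (QV : V → ℝ) (n : ℕ) : (Fin n → V) → ℝ :=
  fun v => ∏ i, QV (v i)

/-- The distribution of the output `V^n` of the memoryless channel `W` when the input is `f w`
with `w` uniform on `{1, …, M}`. -/
def outputDist {U V : Type*} (W : U → V → ℝ) {n M : ℕ} (f : Fin M → Fin n → U) :
    (Fin n → V) → ℝ :=
  fun v => ∑ w, (1 / (M : ℝ)) * ∏ i, W (f w i) (v i)

/-- The number of codewords `2^{nR}`, rounded down to an integer. -/
def numCodewords (R : ℝ) (n : ℕ) : ℕ := ⌊(2 : ℝ) ^ ((n : ℝ) * R)⌋₊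

/-- Some encoder of rate `R` and block length `n` brings the output distribution within
unnormalized divergence less than `ξ` of `QV^n`. There has to be at least one codeword, which
for `n ≥ 1` means `0 ≤ R`. -/
def ApproxWithin {U V : Type*} [Fintype V] (W : U → V → ℝ) (QV : V → ℝ) (R : ℝ) (n : ℕ)
    (ξ : ℝ) : Prop :=
  0 < numCodewords R n ∧
    ∃ f : Fin (numCodewords R n) → Fin n → U,
      divergence (outputDist W f) (prodDist QV n) < (ξ : EReal)

/-- The rate `R` is achievable: for every `ξ > 0` there are a block length `n ≥ 1` and an encoder
with divergence less than `ξ`. -/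
def IsAchievable {U V : Type*} [Fintype V] (W : U → V → ℝ) (QV : V → ℝ) (R : ℝ) : Prop :=
  ∀ ξ : ℝ, 0 < ξ → ∃ n : ℕ, 1 ≤ n ∧ ApproxWithin W QV R n ξ

end

end ProductApprox

/-! Once the output law is fixed to `QV`, the mutual information is the `P`-average of the row
divergences `symbolDivergence`, hence linear in the input law `P`.

Converse: an encoder defines the input law `codeType`. The output law is at least `1/M` times the
law of any single codeword, so small divergence forces the average row divergence to be at most `R +
ξ`. Gibbs' inequality against the product of the average output symbol makes that symbol's law close
to `QV`. Compactness as `ξ → 0` yields an input law with output exactly `QV` and cost at most `R`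
(`IsAchievable.exists_input`); a Carathéodory argument cuts its support to `|V|`
(`exists_support_card_le`).

Direct part: for an i.i.d. random code, Jensen's inequality bounds the mean divergence by the mean
of `log (1 + K / (M T))` (`exists_code_sum_mul_log_le`). With `log (1 + x) ≤ x ^ s / s` this becomes
`ratioMoment ^ n / M ^ s` up to a constant, which decays exponentially for small `s` because the
logarithmic slope of the moment at `0` is the mutual information (`exists_ratioMoment_lt`). -/

namespace ProductApprox

open Real Finset InformationTheory

/-! ### Gibbs' inequality and its equality case. -/

section Divergence

variable {α : Type*} [Fintype α] {p q : α → ℝ}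

/-- The corrections `q a - p a` contained in `klFun` cancel in the sum. The terms on the right are
nonnegative and vanish only at ratio one, so Gibbs' inequality and its equality case follow
termwise. -/
theorem sum_mul_log_div_eq_sum_klFun (hpq : ∀ a, q a = 0 → p a = 0) (hp : ∑ a, p a = 1)
    (hq : ∑ a, q a = 1) :
    ∑ a, p a * log (p a / q a) = ∑ a, q a * klFun (p a / q a) := by
  have h : ∀ a, q a * klFun (p a / q a) = p a * log (p a / q a) + q a - p a := by
    intro a
    by_cases ha : q a = 0
    · simp [ha, hpq a ha]
    · rw [klFun]
      field_simp
  simp only [h, sum_sub_distrib, sum_add_distrib, hp, hq]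
  ring

theorem sum_mul_logb_div (p q : α → ℝ) :
    ∑ a, p a * logb 2 (p a / q a) = (∑ a, p a * log (p a / q a)) / log 2 := by
  rw [sum_div]
  exact sum_congr rfl fun a _ => by rw [logb, mul_div_assoc]

/-- Gibbs' inequality. -/
theorem sum_mul_logb_div_nonneg (hpq : ∀ a, q a = 0 → p a = 0) (hp : p ∈ stdSimplex ℝ α)
    (hq : q ∈ stdSimplex ℝ α) : 0 ≤ ∑ a, p a * logb 2 (p a / q a) := by
  rw [sum_mul_logb_div, sum_mul_log_div_eq_sum_klFun hpq hp.2 hq.2]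
  have : 0 ≤ log 2 := (log_pos one_lt_two).le
  refine div_nonneg (sum_nonneg fun a _ => mul_nonneg (hq.1 a) (klFun_nonneg ?_)) this
  exact div_nonneg (hp.1 a) (hq.1 a)

/-- The equality case of Gibbs' inequality. -/
theorem eq_of_sum_mul_logb_div_nonpos (hpq : ∀ a, q a = 0 → p a = 0) (hp : p ∈ stdSimplex ℝ α)
    (hq : q ∈ stdSimplex ℝ α) (h : ∑ a, p a * logb 2 (p a / q a) ≤ 0) : p = q := by
  have h0 : 0 < log 2 := log_pos one_lt_two
  rw [sum_mul_logb_div, sum_mul_log_div_eq_sum_klFun hpq hp.2 hq.2, div_le_iff₀ h0, zero_mul] at h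
  have hn : ∀ a ∈ univ, 0 ≤ q a * klFun (p a / q a) := fun a _ =>
    mul_nonneg (hq.1 a) (klFun_nonneg (div_nonneg (hp.1 a) (hq.1 a)))
  have hz := (sum_eq_zero_iff_of_nonneg hn).1 (le_antisymm h (sum_nonneg hn))
  funext a
  by_cases ha : q a = 0
  · rw [ha, hpq a ha]
  · have := (mul_eq_zero.1 (hz a (mem_univ a))).resolve_left ha
    rw [klFun_eq_zero_iff (div_nonneg (hp.1 a) (hq.1 a))] at this
    rwa [div_eq_one_iff_eq ha] at this

end Divergence

/-! ### Expectations under product distributions. -/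

section Products

variable {V : Type*} [Fintype V]

/-- Expectation of a function of one coordinate under a product distribution. -/
theorem sum_prod_mul_apply {ι : Type*} [Fintype ι] [DecidableEq ι] {p : ι → V → ℝ}
    (hp : ∀ i, ∑ v, p i v = 1) (g : V → ℝ) (j : ι) :
    ∑ x : ι → V, (∏ i, p i (x i)) * g (x j) = ∑ v, p j v * g v := by
  have h : ∀ x : ι → V, (∏ i, p i (x i)) * g (x j)
      = ∏ i, p i (x i) * (if i = j then g (x i) else 1) := by
    intro x
    rw [prod_mul_distrib, prod_ite_eq' univ j]
    simp
  simp only [h]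
  rw [← Fintype.prod_sum (fun i v => p i v * (if i = j then g v else 1)),
    prod_eq_single j _ (by simp)]
  · simp
  · intro i _ hij
    simp [hij, hp]

/-- Expectation of a product of functions of two coordinates under a product distribution. -/
theorem sum_prod_mul_apply_mul_apply {ι : Type*} [Fintype ι] [DecidableEq ι] {p : V → ℝ}
    (hp : ∑ v, p v = 1) (g h : V → ℝ) {j k : ι} (hjk : j ≠ k) :
    ∑ x : ι → V, (∏ i, p (x i)) * (g (x j) * h (x k))
      = (∑ v, p v * g v) * ∑ v, p v * h v := by
  have e : ∀ x : ι → V, (∏ i, p (x i)) * (g (x j) * h (x k))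
      = ∏ i, p (x i) * ((if i = j then g (x i) else 1) * (if i = k then h (x i) else 1)) := by
    intro x
    rw [prod_mul_distrib, prod_mul_distrib, prod_ite_eq' univ j, prod_ite_eq' univ k]
    simp
  simp only [e]
  rw [← Fintype.prod_sum
    (fun i v => p v * ((if i = j then g v else 1) * (if i = k then h v else 1))),
    prod_eq_mul j k hjk _ (by simp) (by simp)]
  · simp [hjk, hjk.symm]
  · intro i _ hi
    simp [hi.1, hi.2, hp]

theorem prod_mem_stdSimplex {ι : Type*} [Fintype ι] [DecidableEq ι] {p : ι → V → ℝ}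
    (hp : ∀ i, p i ∈ stdSimplex ℝ V) :
    (fun x : ι → V => ∏ i, p i (x i)) ∈ stdSimplex ℝ (ι → V) := by
  refine ⟨fun x => prod_nonneg fun i _ => (hp i).1 _, ?_⟩
  rw [← Fintype.prod_sum p]
  exact prod_eq_one fun i _ => (hp i).2

theorem prodDist_mem_stdSimplex {p : V → ℝ} (hp : p ∈ stdSimplex ℝ V) (n : ℕ) :
    prodDist p n ∈ stdSimplex ℝ (Fin n → V) :=
  prod_mem_stdSimplex fun _ => hp

end Products

/-! ### The output law of a code. -/

section Output

variable {U V : Type*} [Fintype V] {W : U → V → ℝ} {n M : ℕ}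

theorem sum_outputDist_mul (f : Fin M → Fin n → U) (F : (Fin n → V) → ℝ) :
    ∑ x, outputDist W f x * F x = (1 / (M : ℝ)) * ∑ w, ∑ x, (∏ i, W (f w i) (x i)) * F x := by
  simp only [outputDist, sum_mul, mul_sum]
  rw [sum_comm]
  simp only [mul_assoc]

theorem outputDist_mem_stdSimplex (hW : IsChannel W) (hM : 0 < M) (f : Fin M → Fin n → U) :
    outputDist W f ∈ stdSimplex ℝ (Fin n → V) := by
  refine ⟨fun x => sum_nonneg fun w _ => mul_nonneg (by positivity)
    (prod_nonneg fun i _ => (hW _).1 _), ?_⟩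
  have h := sum_outputDist_mul (W := W) f (fun _ => 1)
  have h1 : ∀ w, ∑ x : Fin n → V, ∏ i, W (f w i) (x i) = 1 := fun w =>
    (prod_mem_stdSimplex fun i => hW (f w i)).2
  simp only [mul_one, h1] at h
  rw [h]
  have : (M : ℝ) ≠ 0 := by positivity
  simp [this]

theorem sum_outputDist_mul_sum (hW : IsChannel W) (f : Fin M → Fin n → U) (g : V → ℝ) :
    ∑ x, outputDist W f x * ∑ i, g (x i)
      = (1 / (M : ℝ)) * ∑ w, ∑ i, ∑ v, W (f w i) v * g v := by
  rw [sum_outputDist_mul]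
  congr 1
  refine sum_congr rfl fun w _ => ?_
  simp only [mul_sum]
  rw [sum_comm]
  exact sum_congr rfl fun j _ =>
    sum_prod_mul_apply (p := fun i => W (f w i)) (fun i => (hW (f w i)).2) g j

/-- A codeword symbol that occurs in an encoder is absolutely continuous with respect to the target
as soon as the output distribution is. -/
theorem channel_eq_zero_of_outputDist (hW : IsChannel W) (hM : 0 < M) {QV : V → ℝ}
    {f : Fin M → Fin n → U}
    (h : ∀ x, prodDist QV n x = 0 → outputDist W f x = 0) (w : Fin M) (i : Fin n) {v : V}
    (hv : QV v = 0) : W (f w i) v = 0 := by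
  classical
  have hex : ∀ j, ∃ a, W (f w j) a ≠ 0 := by
    intro j
    by_contra! hc
    have := (hW (f w j)).2
    simp [hc] at this
  choose a ha using hex
  -- All letters other than the `i`-th are possible outputs of codeword `w`, so only factor `i` can
  -- make its probability vanish.
  set x : Fin n → V := Function.update a i v with hx
  have h0 := h x (prod_eq_zero (mem_univ i) (by simpa [hx] using hv))
  have hn : ∀ w ∈ (univ : Finset (Fin M)), 0 ≤ (1 / (M : ℝ)) * ∏ i, W (f w i) (x i) :=
    fun w _ => mul_nonneg (by positivity) (prod_nonneg fun i _ => (hW _).1 _)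
  have h1 := (sum_eq_zero_iff_of_nonneg hn).1 h0 w (mem_univ w)
  have h2 : ∏ i, W (f w i) (x i) = 0 := by
    refine (mul_eq_zero.1 h1).resolve_left ?_
    positivity
  obtain ⟨j, -, hj⟩ := prod_eq_zero_iff.1 h2
  by_cases hji : j = i
  · subst hji
    simpa [hx] using hj
  · rw [hx, Function.update_of_ne hji] at hj
    exact absurd hj (ha j)

end Output

/-! ### Converse: single-letter bounds from a code. -/

section Converse

variable {U V : Type*} [Fintype V] {W : U → V → ℝ} {QV : V → ℝ} {n M : ℕ}

/-- The divergence in bits of the output distribution of the input `u` from `QV`. -/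
noncomputable def symbolDivergence (W : U → V → ℝ) (QV : V → ℝ) (u : U) : ℝ :=
  ∑ v, W u v * logb 2 (W u v / QV v)

/-- The output divergence is at least the divergence of the channel from the target, averaged over
the code, less the logarithm of the number of codewords. -/
theorem average_symbolDivergence_sub_logb_le (hW : IsChannel W) (hQV : QV ∈ stdSimplex ℝ V)
    (hM : 0 < M) (f : Fin M → Fin n → U)
    (hac : ∀ w i v, QV v = 0 → W (f w i) v = 0) :
    (1 / (M : ℝ)) * ∑ w, ∑ i, symbolDivergence W QV (f w i) - logb 2 M
      ≤ ∑ x, outputDist W f x * logb 2 (outputDist W f x / prodDist QV n x) := by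
  have hM' : (0 : ℝ) < M := by exact_mod_cast hM
  have key : ∀ w, ∑ i, symbolDivergence W QV (f w i) - logb 2 M
      ≤ ∑ x : Fin n → V, (∏ i, W (f w i) (x i))
        * logb 2 (outputDist W f x / prodDist QV n x) := by
    intro w
    have e : ∑ i, symbolDivergence W QV (f w i) - logb 2 M
        = ∑ x : Fin n → V, (∏ i, W (f w i) (x i))
          * (∑ i, logb 2 (W (f w i) (x i) / QV (x i)) - logb 2 M) := by
      simp only [mul_sub, sum_sub_distrib, mul_sum, ← sum_mul]
      rw [(prod_mem_stdSimplex fun i => hW (f w i)).2, one_mul, sum_comm]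
      congr 1
      exact sum_congr rfl fun j _ =>
        (sum_prod_mul_apply (p := fun i => W (f w i)) (fun i => (hW (f w i)).2)
          (fun v => logb 2 (W (f w j) v / QV v)) j).symm
    rw [e]
    refine sum_le_sum fun x _ => ?_
    by_cases hz : ∏ i, W (f w i) (x i) = 0
    · simp [hz]
    have hpos : 0 < ∏ i, W (f w i) (x i) :=
      lt_of_le_of_ne (prod_nonneg fun i _ => (hW _).1 _) (Ne.symm hz)
    refine mul_le_mul_of_nonneg_left ?_ hpos.le
    have hWi : ∀ i, W (f w i) (x i) ≠ 0 := fun i => prod_ne_zero_iff.1 hz i (mem_univ i)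
    have hQi : ∀ i, QV (x i) ≠ 0 := fun i h => hWi i (hac w i _ h)
    have hQpos : 0 < prodDist QV n x :=
      prod_pos fun i _ => lt_of_le_of_ne (hQV.1 _) (hQi i).symm
    rw [← logb_prod _ _ fun i _ => div_ne_zero (hWi i) (hQi i), prod_div_distrib]
    change logb 2 (_ / prodDist QV n x) - _ ≤ _
    rw [← logb_div (div_ne_zero hz hQpos.ne') hM'.ne']
    refine logb_le_logb_of_le one_lt_two (by positivity) ?_
    change (∏ i, W (f w i) (x i)) / prodDist QV n x / M ≤ _
    rw [div_right_comm]
    refine div_le_div_of_nonneg_right ?_ hQpos.le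
    -- The average over the code is at least its single summand `w`; this costs the `logb 2 M`.
    have := single_le_sum (f := fun w => (1 / (M : ℝ)) * ∏ i, W (f w i) (x i))
      (fun w _ => mul_nonneg (by positivity) (prod_nonneg fun i _ => (hW _).1 _)) (mem_univ w)
    rw [div_eq_inv_mul, inv_eq_one_div]
    exact this
  rw [sum_outputDist_mul]
  have h := mul_le_mul_of_nonneg_left (sum_le_sum fun w (_ : w ∈ univ) => key w)
    (one_div_pos.2 hM').le
  rw [sum_sub_distrib, mul_sub] at h
  have hc : 1 / (M : ℝ) * ∑ _w : Fin M, logb 2 (M : ℝ) = logb 2 M := by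
    simp [hM'.ne']
  rwa [hc] at h

open Classical in
/-- The relative frequency of a symbol among all positions of all codewords. -/
noncomputable def codeType {U : Type*} {n M : ℕ} (f : Fin M → Fin n → U) (u : U) : ℝ :=
  (∑ w, ∑ i, if f w i = u then 1 else 0) / (M * n)

theorem sum_codeType_mul {U : Type*} [Fintype U] {n M : ℕ} (f : Fin M → Fin n → U) (g : U → ℝ) :
    ∑ u, codeType f u * g u = (∑ w, ∑ i, g (f w i)) / (M * n) := by
  classical
  simp only [codeType, div_mul_eq_mul_div, ← sum_div, sum_mul]
  rw [sum_comm]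
  congr 1
  refine sum_congr rfl fun w _ => ?_
  rw [sum_comm]
  simp

theorem codeType_mem_stdSimplex {U : Type*} [Fintype U] {n M : ℕ} (hM : 0 < M) (hn : 0 < n)
    (f : Fin M → Fin n → U) :
    codeType f ∈ stdSimplex ℝ U := by
  classical
  refine ⟨fun u => div_nonneg (sum_nonneg fun w _ => sum_nonneg fun i _ => ?_) (by positivity), ?_⟩
  · split_ifs <;> norm_num
  · have h := sum_codeType_mul f fun _ => 1
    have : (M : ℝ) * n ≠ 0 := by positivity
    simpa [this] using h

theorem exists_of_codeType_ne_zero {U : Type*} {n M : ℕ} {f : Fin M → Fin n → U} {u : U}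
    (h : codeType f u ≠ 0) :
    ∃ w i, f w i = u := by
  classical
  by_contra! hc
  simp [codeType, hc] at h

/-- The distribution of the channel output when the input has distribution `P`. -/
noncomputable def inducedOutput {U V : Type*} [Fintype U] (W : U → V → ℝ) (P : U → ℝ) (v : V) :
    ℝ := ∑ u, P u * W u v

variable [Fintype U]

theorem sum_inducedOutput_mul (P : U → ℝ) (g : V → ℝ) :
    ∑ v, inducedOutput W P v * g v = ∑ u, P u * ∑ v, W u v * g v := by
  simp only [inducedOutput, sum_mul, mul_sum]
  rw [sum_comm]
  simp only [mul_assoc]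

theorem inducedOutput_mem_stdSimplex (hW : IsChannel W) {P : U → ℝ} (hP : P ∈ stdSimplex ℝ U) :
    inducedOutput W P ∈ stdSimplex ℝ V := by
  refine ⟨fun v => sum_nonneg fun u _ => mul_nonneg (hP.1 u) ((hW u).1 v), ?_⟩
  have h := sum_inducedOutput_mul (W := W) P fun _ => 1
  simp only [mul_one, (hW _).2, hP.2] at h
  exact h

theorem inducedOutput_codeType {U V : Type*} [Fintype U] {W : U → V → ℝ} {n M : ℕ}
    (f : Fin M → Fin n → U) (v : V) :
    inducedOutput W (codeType f) v = (∑ w, ∑ i, W (f w i) v) / (M * n) :=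
  sum_codeType_mul f fun u => W u v

/-- The output divergence is at least `n` times the divergence of the average output symbol. -/
theorem mul_sum_inducedOutput_le (hW : IsChannel W) (hM : 0 < M) (hn : 0 < n)
    (f : Fin M → Fin n → U)
    (hac : ∀ x, prodDist QV n x = 0 → outputDist W f x = 0) :
    n * ∑ v, inducedOutput W (codeType f) v * logb 2 (inducedOutput W (codeType f) v / QV v)
      ≤ ∑ x, outputDist W f x * logb 2 (outputDist W f x / prodDist QV n x) := by
  set T := inducedOutput W (codeType f) with hT
  have hM' : (0 : ℝ) < M := by exact_mod_cast hM
  have hn' : (0 : ℝ) < n := by exact_mod_cast hn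
  have hTs : T ∈ stdSimplex ℝ V :=
    inducedOutput_mem_stdSimplex hW (codeType_mem_stdSimplex hM hn f)
  have hO := outputDist_mem_stdSimplex hW hM f
  have hTz : ∀ x : Fin n → V, outputDist W f x ≠ 0 → ∀ i, T (x i) ≠ 0 := by
    intro x hx i hTi
    apply hx
    rw [hT, inducedOutput_codeType, div_eq_zero_iff] at hTi
    have h0 := hTi.resolve_right (by positivity)
    have hnn : ∀ w ∈ (univ : Finset (Fin M)), 0 ≤ ∑ j, W (f w j) (x i) :=
      fun w _ => sum_nonneg fun j _ => (hW _).1 _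
    refine sum_eq_zero fun w _ => ?_
    have h1 := (sum_eq_zero_iff_of_nonneg hnn).1 h0 w (mem_univ w)
    have h2 := (sum_eq_zero_iff_of_nonneg fun j _ => (hW _).1 _).1 h1 i (mem_univ i)
    rw [prod_eq_zero (mem_univ i) h2, mul_zero]
  -- The divergence from `T^n` is exactly the difference of the two sides of the claim.
  have hG := sum_mul_logb_div_nonneg (p := outputDist W f) (q := prodDist T n)
    (fun x hx => by
      by_contra hc
      obtain ⟨i, -, hi⟩ := prod_eq_zero_iff.1 hx
      exact hTz x hc i hi) hO (prodDist_mem_stdSimplex hTs n)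
  have e1 : n * ∑ v, T v * logb 2 (T v / QV v)
      = ∑ x, outputDist W f x * ∑ i, logb 2 (T (x i) / QV (x i)) := by
    rw [sum_outputDist_mul_sum hW f fun v => logb 2 (T v / QV v), hT,
      sum_inducedOutput_mul, sum_codeType_mul f fun u => ∑ v, W u v * logb 2 (T v / QV v)]
    field_simp
    rfl
  rw [e1, ← sub_nonneg, ← sum_sub_distrib]
  convert hG using 1
  refine sum_congr rfl fun x _ => ?_
  by_cases hx : outputDist W f x = 0
  · simp [hx]
  rw [← mul_sub]
  congr 1
  have hQ : prodDist QV n x ≠ 0 := fun h => hx (hac x h)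
  have hQi : ∀ i, QV (x i) ≠ 0 := fun i => prod_ne_zero_iff.1 hQ i (mem_univ i)
  have hTp : prodDist T n x ≠ 0 := prod_ne_zero_iff.2 fun i _ => hTz x hx i
  have e2 : ∑ i, logb 2 (T (x i) / QV (x i)) = logb 2 (prodDist T n x / prodDist QV n x) := by
    rw [← logb_prod _ _ fun i _ => div_ne_zero (hTz x hx i) (hQi i), prod_div_distrib]
    rfl
  rw [e2, logb_div hx hQ, logb_div hTp hQ, logb_div hx hTp]
  ring

theorem logb_numCodewords_le {R : ℝ} (h : 0 < numCodewords R n) :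
    logb 2 (numCodewords R n) ≤ n * R := by
  rw [logb_le_iff_le_rpow one_lt_two (by exact_mod_cast h)]
  exact Nat.floor_le (by positivity)

/-- A good encoder yields an input distribution that nearly meets the constraints. -/
theorem ApproxWithin.exists_input (hW : IsChannel W) (hQV : QV ∈ stdSimplex ℝ V) {R ξ : ℝ}
    (hξ : 0 < ξ) (hn : 1 ≤ n) (h : ApproxWithin W QV R n ξ) :
    ∃ P ∈ stdSimplex ℝ U, (∀ u v, QV v = 0 → P u * W u v = 0) ∧
      ∑ u, P u * symbolDivergence W QV u ≤ R + ξ ∧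
      ∑ v, inducedOutput W P v * logb 2 (inducedOutput W P v / QV v) ≤ ξ := by
  obtain ⟨hM, f, hf⟩ := h
  have hac : ∀ x, prodDist QV n x = 0 → outputDist W f x = 0 := by
    by_contra hc
    rw [divergence, if_neg hc] at hf
    exact absurd hf (not_lt.2 le_top)
  rw [divergence, if_pos hac, EReal.coe_lt_coe_iff] at hf
  have hac' := fun w i v => channel_eq_zero_of_outputDist hW hM hac w i (v := v)
  have hn' : (1 : ℝ) ≤ n := by exact_mod_cast hn
  have hM' : (0 : ℝ) < numCodewords R n := by exact_mod_cast hM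
  -- Per letter the error is `ξ / n`; bounding it by `ξ` suffices, so `n` need not grow.
  have hξn : ξ ≤ n * ξ := le_mul_of_one_le_left hξ.le hn'
  refine ⟨codeType f, codeType_mem_stdSimplex hM hn f, fun u v hv => ?_, ?_, ?_⟩
  · by_cases hu : codeType f u = 0
    · rw [hu, zero_mul]
    · obtain ⟨w, i, rfl⟩ := exists_of_codeType_ne_zero hu
      rw [hac' w i v hv, mul_zero]
  · have h1 := average_symbolDivergence_sub_logb_le hW hQV hM f hac'
    have h2 := logb_numCodewords_le hM
    rw [sum_codeType_mul]
    have h3 : (∑ w, ∑ i, symbolDivergence W QV (f w i)) / (numCodewords R n * n)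
        = ((1 / (numCodewords R n : ℝ)) * ∑ w, ∑ i, symbolDivergence W QV (f w i)) / n := by
      field_simp
    rw [h3, div_le_iff₀ (by linarith)]
    nlinarith
  · have h1 := mul_sum_inducedOutput_le hW hM hn f hac
    have h2 : (n : ℝ) * ∑ v, inducedOutput W (codeType f) v
        * logb 2 (inducedOutput W (codeType f) v / QV v) ≤ n * ξ := by linarith
    exact le_of_mul_le_mul_left h2 (by linarith)

end Converse

/-! ### Support reduction and passage to the limit. -/

section SupportReduction

open Filter Topology

variable {U V : Type*} [Fintype U] [Fintype V] {W : U → V → ℝ} {QV : V → ℝ}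

/-- More rows of a channel than output symbols satisfy a nontrivial linear relation. -/
theorem exists_relation_of_card_lt (hW : IsChannel W) (d : U → ℝ) (s : Finset U)
    (hs : Fintype.card V < #s) :
    ∃ c : U → ℝ, (∀ u ∉ s, c u = 0) ∧ (∃ u, c u < 0) ∧ (∀ v, ∑ u, c u * W u v = 0) ∧
      ∑ u, c u * d u ≤ 0 := by
  classical
  have hli : ¬ LinearIndependent ℝ fun u : s => W u := by
    intro h
    have := h.fintype_card_le_finrank
    simp only [Fintype.card_coe, Module.finrank_fintype_fun_eq_card] at this
    omega
  obtain ⟨g, hg, ⟨u₀, hu₀⟩, hg0⟩ := Fintype.not_linearIndependent_iff.1 hli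
  set b : U → ℝ := fun u => if h : u ∈ s then g ⟨u, h⟩ else 0 with hb
  have hbs : ∀ u ∉ s, b u = 0 := fun u hu => by simp [hb, hu]
  have hb0 : b u₀ ≠ 0 := by simpa [hb, hu₀] using hg0
  have hbW : ∀ v, ∑ u, b u * W u v = 0 := by
    intro v
    have h1 := congrFun hg v
    simp only [Finset.sum_apply, Pi.smul_apply, smul_eq_mul, Pi.zero_apply] at h1
    rw [← h1, ← sum_subset (subset_univ s) fun u _ hu => by rw [hbs u hu, zero_mul],
      ← sum_coe_sort s]
    exact sum_congr rfl fun u _ => by simp [hb]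
  -- Rows sum to one, so summing the relation over `v` shows that the coefficients sum to zero;
  -- hence both signs occur, and the sign can be chosen by cost.
  have hbsum : ∑ u, b u = 0 := by
    have h1 : ∑ v, ∑ u, b u * W u v = 0 := sum_eq_zero fun v _ => hbW v
    rw [sum_comm] at h1
    simpa only [← mul_sum, (hW _).2, mul_one] using h1
  have hneg : ∀ c : U → ℝ, ∑ u, c u = 0 → (∃ u, c u ≠ 0) → ∃ u, c u < 0 := by
    rintro c hc ⟨u, hu⟩
    by_contra! h
    exact hu ((sum_eq_zero_iff_of_nonneg fun u _ => h u).1 hc u (mem_univ u))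
  rcases le_total (∑ u, b u * d u) 0 with h | h
  · exact ⟨b, hbs, hneg b hbsum ⟨u₀, hb0⟩, hbW, h⟩
  · refine ⟨fun u => -b u, fun u hu => by simp [hbs u hu],
      hneg _ (by simp [hbsum]) ⟨u₀, by simpa using hb0⟩, fun v => ?_, ?_⟩
    · simp [hbW v]
    · simpa using h

/-- An input distribution can be replaced by one with at most `|V|` symbols that induces the same
output and does not have a larger linear cost. -/
theorem exists_support_card_le (hW : IsChannel W) (d : U → ℝ) (P : U → ℝ) (hP : ∀ u, 0 ≤ P u) :
    ∃ P' : U → ℝ, (∀ u, 0 ≤ P' u) ∧ (∀ u, P u = 0 → P' u = 0) ∧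
      inducedOutput W P' = inducedOutput W P ∧ ∑ u, P' u * d u ≤ ∑ u, P u * d u ∧
      (Function.support P').ncard ≤ Fintype.card V := by
  classical
  induction hk : #{u | P u ≠ 0} using Nat.strong_induction_on generalizing P with
  | _ k ih =>
  by_cases hc : #{u | P u ≠ 0} ≤ Fintype.card V
  · refine ⟨P, hP, fun _ h => h, rfl, le_rfl, ?_⟩
    convert hc
    rw [← Set.ncard_coe_finset]
    congr 1
    ext u
    simp
  obtain ⟨c, hcs, ⟨u₁, hu₁⟩, hcW, hcd⟩ := exists_relation_of_card_lt hW d _ (not_le.1 hc)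
  have hc0 : ∀ u, P u = 0 → c u = 0 := fun u hu => hcs u (by simp [hu])
  -- Ratio test: `t` is the largest step along `c` that keeps all masses nonnegative, and it empties
  -- `u₀`.
  obtain ⟨u₀, hu₀, hmin⟩ := exists_min_image {u | c u < 0} (fun u => P u / -c u)
    ⟨u₁, by simpa using hu₁⟩
  simp only [mem_filter, mem_univ, true_and] at hu₀ hmin
  set t := P u₀ / -c u₀ with ht
  have ht0 : 0 ≤ t := div_nonneg (hP _) (by linarith)
  set P₁ : U → ℝ := fun u => P u + t * c u with hP₁
  have hP₁0 : ∀ u, 0 ≤ P₁ u := by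
    intro u
    rcases lt_or_ge (c u) 0 with h | h
    · have := hmin u h
      rw [le_div_iff₀ (by linarith)] at this
      simp only [hP₁]
      linarith
    · exact add_nonneg (hP u) (mul_nonneg ht0 h)
  have hsub : ∀ u, P u = 0 → P₁ u = 0 := fun u hu => by simp [hP₁, hu, hc0 u hu]
  have hu₀P : P₁ u₀ = 0 := by
    simp only [hP₁, ht]
    field_simp [hu₀.ne]
    ring
  have hlt : #{u | P₁ u ≠ 0} < k := by
    rw [← hk]
    refine card_lt_card ⟨fun u hu => ?_, fun h => ?_⟩
    · simp only [mem_filter, mem_univ, true_and] at hu ⊢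
      exact fun h => hu (hsub u h)
    · have h0 : u₀ ∈ ({u | P u ≠ 0} : Finset U) := by
        simpa using fun h => hu₀.ne (hc0 u₀ h)
      simpa [hu₀P] using h h0
  obtain ⟨P', h1, h2, h3, h4, h5⟩ := ih _ hlt P₁ hP₁0 rfl
  refine ⟨P', h1, fun u hu => h2 u (hsub u hu), ?_, h4.trans ?_, h5⟩
  · rw [h3]
    funext v
    simp only [inducedOutput, hP₁, add_mul, sum_add_distrib, mul_assoc, ← mul_sum, hcW v]
    simp
  · simp only [hP₁, add_mul, sum_add_distrib, mul_assoc, ← mul_sum]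
    nlinarith

theorem continuous_inducedOutput {U V : Type*} [Fintype U] {W : U → V → ℝ} (v : V) :
    Continuous fun P : U → ℝ => inducedOutput W P v := by
  unfold inducedOutput
  fun_prop

/-- For `c = 0` the function is constantly `0` by the conventions for division and logarithm. The
limit then loses all control of letters outside the support of `QV`, so absolute continuity is
passed to the limit separately. -/
theorem continuous_mul_logb_div (c : ℝ) : Continuous fun x : ℝ => x * logb 2 (x / c) := by
  by_cases hc : c = 0
  · simpa [hc] using continuous_const
  · have h : (fun x : ℝ => x * logb 2 (x / c)) = fun x => c / log 2 * (x / c * log (x / c)) := by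
      funext x
      rw [logb]
      field_simp
    rw [h]
    exact continuous_const.mul (continuous_mul_log.comp (continuous_id.div_const c))

/-- If `R` is achievable, then some input distribution induces the target exactly and has average
symbol divergence at most `R`. -/
theorem IsAchievable.exists_input (hW : IsChannel W) (hQV : QV ∈ stdSimplex ℝ V) {R : ℝ}
    (h : IsAchievable W QV R) :
    ∃ P ∈ stdSimplex ℝ U, ∑ u, P u * symbolDivergence W QV u ≤ R ∧ inducedOutput W P = QV := by
  have hk : ∀ k : ℕ, ∃ P ∈ stdSimplex ℝ U, (∀ u v, QV v = 0 → P u * W u v = 0) ∧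
      ∑ u, P u * symbolDivergence W QV u ≤ R + 1 / ((k : ℝ) + 1) ∧
      ∑ v, inducedOutput W P v * logb 2 (inducedOutput W P v / QV v) ≤ 1 / ((k : ℝ) + 1) := by
    intro k
    obtain ⟨n, hn, hA⟩ := h (1 / ((k : ℝ) + 1)) (by positivity)
    exact hA.exists_input hW hQV (by positivity) hn
  choose p hp hac hL hD using hk
  obtain ⟨P, hP, φ, hφ, hlim⟩ := (isCompact_stdSimplex ℝ U).tendsto_subseq hp
  have hε : Tendsto (fun k => 1 / ((φ k : ℝ) + 1)) atTop (𝓝 0) :=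
    tendsto_one_div_add_atTop_nhds_zero_nat.comp hφ.tendsto_atTop
  have hPac : ∀ u v, QV v = 0 → P u * W u v = 0 := by
    intro u v hv
    have hc : Continuous fun P : U → ℝ => P u * W u v := by fun_prop
    refine tendsto_nhds_unique ((hc.tendsto P).comp hlim) ?_
    simp [Function.comp_def, hac _ u v hv]
  refine ⟨P, hP, ?_, ?_⟩
  · have hc : Continuous fun P : U → ℝ => ∑ u, P u * symbolDivergence W QV u := by fun_prop
    refine le_of_tendsto_of_tendsto' ((hc.tendsto P).comp hlim) ?_ fun k => hL (φ k)
    simpa using hε.const_add R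
  · refine eq_of_sum_mul_logb_div_nonpos (fun v hv => sum_eq_zero fun u _ => hPac u v hv)
      (inducedOutput_mem_stdSimplex hW hP) hQV ?_
    have hc : Continuous fun P : U → ℝ =>
        ∑ v, inducedOutput W P v * logb 2 (inducedOutput W P v / QV v) :=
      continuous_finsetSum _ fun v _ =>
        (continuous_mul_logb_div (QV v)).comp (continuous_inducedOutput v)
    exact le_of_tendsto_of_tendsto' ((hc.tendsto P).comp hlim) hε fun k => hD (φ k)

theorem IsAdmissibleJoint.mutualInfo_eq {Q : U × V → ℝ} (hQ : IsAdmissibleJoint W QV Q) :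
    mutualInfo Q = ∑ u, marginalU Q u * symbolDivergence W QV u := by
  simp only [mutualInfo, symbolDivergence, mul_sum]
  refine sum_congr rfl fun u _ => sum_congr rfl fun v _ => ?_
  rw [hQ.eq_mul_channel, hQ.marginalV_eq]
  by_cases hu : marginalU Q u = 0
  · simp [hu]
  · rw [mul_div_mul_left _ _ hu, mul_assoc]

theorem isAdmissibleJoint_mul (hW : IsChannel W) (hQV : QV ∈ stdSimplex ℝ V) {P : U → ℝ}
    (hP : ∀ u, 0 ≤ P u) (hout : inducedOutput W P = QV)
    (hcard : (Function.support P).ncard ≤ Fintype.card V) :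
    marginalU (fun x : U × V => P x.1 * W x.1 x.2) = P ∧
      IsAdmissibleJoint W QV fun x : U × V => P x.1 * W x.1 x.2 := by
  have hm : marginalU (fun x : U × V => P x.1 * W x.1 x.2) = P := by
    funext u
    simp [marginalU, ← mul_sum, (hW u).2]
  refine ⟨hm, ⟨fun x => mul_nonneg (hP _) ((hW _).1 _), ?_⟩, hout, fun u v => by rw [hm],
    by rwa [hm]⟩
  rw [Fintype.sum_prod_type, sum_comm, ← hQV.2, ← hout]
  rfl

theorem not_isAchievable (hW : IsChannel W) (hQV : QV ∈ stdSimplex ℝ V) {R : ℝ}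
    (h : ∀ Q : U × V → ℝ, IsAdmissibleJoint W QV Q → R < mutualInfo Q) :
    ¬ IsAchievable W QV R := by
  intro hA
  obtain ⟨P, hP, hPR, hPout⟩ := hA.exists_input hW hQV
  obtain ⟨P', h0, -, hout, hcost, hcard⟩ :=
    exists_support_card_le hW (symbolDivergence W QV) P hP.1
  obtain ⟨hm, hQ⟩ := isAdmissibleJoint_mul hW hQV h0 (hout.trans hPout) hcard
  have h1 := h _ hQ
  rw [hQ.mutualInfo_eq, hm] at h1
  linarith

end SupportReduction

/-! ### One-shot random coding. -/

section RandomCoding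

/-- Subadditivity of `x ^ s` gives `(1 + x) ^ s ≤ 1 + x ^ s`; then use `log y ≤ y - 1`. -/
theorem log_one_add_le_rpow_div {x s : ℝ} (hx : 0 ≤ x) (hs : 0 < s) (hs1 : s ≤ 1) :
    log (1 + x) ≤ x ^ s / s := by
  have h1 : (1 + x) ^ s ≤ 1 + x ^ s := by
    simpa using rpow_add_le_add_rpow zero_le_one hx hs.le hs1
  have hxs : 0 ≤ x ^ s := rpow_nonneg hx s
  rw [le_div_iff₀ hs, mul_comm, ← log_rpow (by positivity)]
  have h2 := log_le_log (rpow_pos_of_pos (by positivity) s) h1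
  have h3 := log_le_sub_one_of_pos (show 0 < 1 + x ^ s by positivity)
  linarith

/-- The random-coding bound for one codeword `w` and one output letter `b`: Jensen's inequality
for the logarithm over the codewords other than `w`. -/
theorem sum_prod_mul_log_average_le {A B : Type*} [Fintype A] {K : A → B → ℝ} {P : A → ℝ}
    {T : B → ℝ} {M : ℕ} (hK : ∀ a b, 0 ≤ K a b) (hP : P ∈ stdSimplex ℝ A)
    (hT : ∀ b, ∑ a, P a * K a b = T b) (w : Fin M) (b : B) :
    ∑ f : Fin M → A, (∏ i, P (f i)) * (K (f w) b * log ((∑ w', 1 / (M : ℝ) * K (f w') b) / T b))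
      ≤ ∑ a, P a * (K a b * log (1 + K a b / (M * T b))) := by
  have hM : 0 < M := w.pos
  have hM' : (0 : ℝ) < M := by exact_mod_cast hM
  have hTn : 0 ≤ T b := hT b ▸ sum_nonneg fun a _ => mul_nonneg (hP.1 a) (hK a b)
  set y : A → ℝ := fun a => 1 + K a b / (M * T b) with hy
  have hy1 : ∀ a, 1 ≤ y a := fun a => le_add_of_nonneg_right (by have := hK a b; positivity)
  have hy0 : ∀ a, 0 < y a := fun a => one_pos.trans_le (hy1 a)
  set G : A → ℝ := fun a => K a b / y a with hG
  have hG0 : ∀ a, 0 ≤ G a := fun a => div_nonneg (hK a b) (hy0 a).le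
  have hPf : ∀ f : Fin M → A, 0 ≤ ∏ i, P (f i) := fun f => prod_nonneg fun i _ => hP.1 _
  rcases hTn.eq_or_lt with hT0 | hTpos
  · have hz : ∀ a, P a * K a b = 0 := by
      have := hT b
      rw [← hT0, sum_eq_zero_iff_of_nonneg fun a _ => mul_nonneg (hP.1 a) (hK a b)] at this
      exact fun a => this a (mem_univ a)
    refine le_of_eq ?_
    rw [sum_eq_zero, sum_eq_zero]
    · intro a _
      rw [← mul_assoc, hz, zero_mul]
    · intro f _
      rcases mul_eq_zero.1 (hz (f w)) with h | h
      · rw [prod_eq_zero (mem_univ w) h, zero_mul]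
      · rw [h, zero_mul, mul_zero]
  -- Jensen by a tangent line: `log X ≤ log y + X / y - 1`, where `y` is `1 / M` more than the
  -- conditional mean of `X` given codeword `w`.
  have hpt : ∀ f : Fin M → A,
      (∏ i, P (f i)) * (K (f w) b * log ((∑ w', 1 / (M : ℝ) * K (f w') b) / T b))
        ≤ (∏ i, P (f i)) * (K (f w) b * log (y (f w)))
          + ((1 / (M * T b)) * ∑ w' ∈ univ.erase w, (∏ i, P (f i)) * (G (f w) * K (f w') b)
            - (∏ i, P (f i)) * G (f w)) := by
    intro f
    have e : (∏ i, P (f i)) * (K (f w) b * log (y (f w)))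
          + ((1 / (M * T b)) * ∑ w' ∈ univ.erase w, (∏ i, P (f i)) * (G (f w) * K (f w') b)
            - (∏ i, P (f i)) * G (f w))
        = (∏ i, P (f i)) * (K (f w) b * log (y (f w))
          + G (f w) * ((∑ w' ∈ univ.erase w, K (f w') b) / (M * T b) - 1)) := by
      simp only [← mul_sum]
      ring
    rw [e]
    refine mul_le_mul_of_nonneg_left ?_ (hPf f)
    set X := (∑ w', 1 / (M : ℝ) * K (f w') b) / T b with hX
    have hXe : X = K (f w) b / (M * T b) + (∑ w' ∈ univ.erase w, K (f w') b) / (M * T b) := by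
      rw [hX, ← mul_sum, ← add_sum_erase _ _ (mem_univ w)]
      field_simp
    rcases (hK (f w) b).eq_or_lt with h0 | hpos
    · simp [← h0, hG]
    have hXpos : 0 < X := by
      rw [hXe]
      have : 0 ≤ ∑ w' ∈ univ.erase w, K (f w') b := sum_nonneg fun _ _ => hK _ _
      positivity
    have hlog := log_le_sub_one_of_pos (div_pos hXpos (hy0 (f w)))
    rw [log_div hXpos.ne' (hy0 _).ne'] at hlog
    have hXy : X / y (f w) - 1
        = ((∑ w' ∈ univ.erase w, K (f w') b) / (M * T b) - 1) / y (f w) := by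
      rw [div_sub_one (hy0 _).ne', hXe]
      simp only [hy]
      ring_nf
    rw [hXy] at hlog
    calc K (f w) b * log X
        ≤ K (f w) b * (log (y (f w))
          + ((∑ w' ∈ univ.erase w, K (f w') b) / (M * T b) - 1) / y (f w)) :=
          mul_le_mul_of_nonneg_left (by linarith) (hK _ _)
      _ = _ := by simp only [hG]; ring
  refine (sum_le_sum fun f _ => hpt f).trans ?_
  rw [sum_add_distrib, sum_sub_distrib, ← mul_sum, sum_comm,
    sum_prod_mul_apply (p := fun _ => P) (fun _ => hP.2) (fun a => K a b * log (y a)) w,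
    sum_prod_mul_apply (p := fun _ => P) (fun _ => hP.2) G w]
  have hpair : ∀ w' ∈ univ.erase w,
      ∑ f : Fin M → A, (∏ i, P (f i)) * (G (f w) * K (f w') b) = (∑ a, P a * G a) * T b := by
    intro w' hw'
    rw [sum_prod_mul_apply_mul_apply hP.2 G (fun a => K a b) (ne_of_mem_erase hw').symm, hT]
  rw [sum_congr rfl hpair, sum_const, card_erase_of_mem (mem_univ w), card_univ, Fintype.card_fin,
    nsmul_eq_mul, Nat.cast_pred hM]
  have hE : 0 ≤ ∑ a, P a * G a := sum_nonneg fun a _ => mul_nonneg (hP.1 a) (hG0 a)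
  -- Only `M - 1` other codewords contribute, so the linear term has nonpositive mean.
  have e : 1 / (M * T b) * ((M - 1) * ((∑ a, P a * G a) * T b)) - ∑ a, P a * G a
      = -((∑ a, P a * G a) / M) := by
    field_simp
    ring
  rw [e]
  have := div_nonneg hE hM'.le
  linarith

/-- One-shot soft covering: some code with codewords of positive probability does at least as well
as the random code with independent codewords of distribution `P`. -/
theorem exists_code_sum_mul_log_le {A B : Type*} [Fintype A] [Fintype B] {K : A → B → ℝ}
    {P : A → ℝ} {T : B → ℝ} {M : ℕ} (hK : ∀ a b, 0 ≤ K a b) (hP : P ∈ stdSimplex ℝ A)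
    (hT : ∀ b, ∑ a, P a * K a b = T b) (hM : 0 < M) :
    ∃ f : Fin M → A, (∀ w, P (f w) ≠ 0) ∧
      ∑ b, (∑ w, 1 / (M : ℝ) * K (f w) b) * log ((∑ w, 1 / (M : ℝ) * K (f w) b) / T b)
        ≤ ∑ a, ∑ b, P a * (K a b * log (1 + K a b / (M * T b))) := by
  have hM' : (0 : ℝ) < M := by exact_mod_cast hM
  set D : (Fin M → A) → ℝ := fun f =>
    ∑ b, (∑ w, 1 / (M : ℝ) * K (f w) b) * log ((∑ w, 1 / (M : ℝ) * K (f w) b) / T b) with hD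
  set C := ∑ a, ∑ b, P a * (K a b * log (1 + K a b / (M * T b))) with hC
  have hμ := prod_mem_stdSimplex (ι := Fin M) fun _ => hP
  have havg : ∑ f : Fin M → A, (∏ i, P (f i)) * D f ≤ C := by
    have e : ∑ f : Fin M → A, (∏ i, P (f i)) * D f = ∑ w : Fin M, 1 / (M : ℝ) *
        ∑ b, ∑ f : Fin M → A, (∏ i, P (f i))
          * (K (f w) b * log ((∑ w', 1 / (M : ℝ) * K (f w') b) / T b)) := by
      simp only [hD, mul_sum, sum_mul]
      rw [sum_comm]
      simp only [sum_comm (s := (univ : Finset (Fin M → A)))]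
      rw [sum_comm]
      refine sum_congr rfl fun w _ => sum_congr rfl fun b _ => sum_congr rfl fun f _ => ?_
      ring
    rw [e]
    have hb : ∀ w : Fin M, ∑ b, ∑ f : Fin M → A, (∏ i, P (f i))
          * (K (f w) b * log ((∑ w', 1 / (M : ℝ) * K (f w') b) / T b)) ≤ C := by
      intro w
      have hC' : C = ∑ b, ∑ a, P a * (K a b * log (1 + K a b / (M * T b))) := sum_comm
      rw [hC']
      exact sum_le_sum fun b _ => sum_prod_mul_log_average_le hK hP hT w b
    calc _ ≤ ∑ _w : Fin M, 1 / (M : ℝ) * C :=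
          sum_le_sum fun w _ => mul_le_mul_of_nonneg_left (hb w) (by positivity)
      _ = C := by
          simp only [sum_const, card_univ, Fintype.card_fin, nsmul_eq_mul]
          field_simp
  -- Codes using a symbol of mass zero have weight zero, so they can be excluded from the averaging
  -- argument.
  by_contra! hc
  have hpos : ∀ f : Fin M → A, 0 ≤ (∏ i, P (f i)) * (D f - C) := by
    intro f
    by_cases hf : ∀ w, P (f w) ≠ 0
    · exact mul_nonneg (hμ.1 f) (sub_nonneg.2 (hc f hf).le)
    · push Not at hf
      obtain ⟨w, hw⟩ := hf
      rw [prod_eq_zero (mem_univ w) hw, zero_mul]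
  have hsum : ∑ f : Fin M → A, (∏ i, P (f i)) * (D f - C) ≤ 0 := by
    simp only [mul_sub, sum_sub_distrib, ← sum_mul]
    rw [hμ.2]
    linarith
  have hzero := (sum_eq_zero_iff_of_nonneg fun f _ => hpos f).1
    (le_antisymm hsum (sum_nonneg fun f _ => hpos f))
  have h0 : ∑ f : Fin M → A, ∏ i, P (f i) = 0 := by
    refine sum_eq_zero fun f hf => ?_
    by_contra hne
    have hw : ∀ w, P (f w) ≠ 0 := fun w => prod_ne_zero_iff.1 hne w (mem_univ w)
    have := (mul_eq_zero.1 (hzero f hf)).resolve_left hne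
    linarith [hc f hw]
  linarith [hμ.2]

end RandomCoding

/-! ### Direct part: exponential decay for memoryless channels. -/

section Direct

open Filter Topology

variable {U V : Type*} [Fintype U] [Fintype V] {W : U → V → ℝ} {QV : V → ℝ}

theorem sum_sum_prod_eq_pow (h : U → V → ℝ) (n : ℕ) :
    ∑ a : Fin n → U, ∑ b : Fin n → V, ∏ i, h (a i) (b i) = (∑ u, ∑ v, h u v) ^ n := by
  have e : ∀ a : Fin n → U, ∑ b : Fin n → V, ∏ i, h (a i) (b i) = ∏ i, ∑ v, h (a i) v :=
    fun a => (Fintype.prod_sum fun i v => h (a i) v).symm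
  simp only [e]
  rw [← Fintype.prod_sum fun (_ : Fin n) u => ∑ v, h u v]
  simp

theorem IsAdmissibleJoint.marginalU_mem_stdSimplex {Q : U × V → ℝ}
    (hQ : IsAdmissibleJoint W QV Q) : marginalU Q ∈ stdSimplex ℝ U := by
  refine ⟨fun u => sum_nonneg fun v _ => hQ.mem_stdSimplex.1 _, ?_⟩
  rw [← hQ.mem_stdSimplex.2, Fintype.sum_prod_type]
  rfl

theorem IsAdmissibleJoint.inducedOutput_eq {Q : U × V → ℝ} (hQ : IsAdmissibleJoint W QV Q) :
    inducedOutput W (marginalU Q) = QV := by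
  rw [← hQ.marginalV_eq]
  funext v
  simp only [inducedOutput, marginalV]
  exact sum_congr rfl fun u _ => (hQ.eq_mul_channel u v).symm

theorem mul_eq_zero_of_inducedOutput (hW : IsChannel W) {P : U → ℝ} (hP : ∀ u, 0 ≤ P u)
    (hout : inducedOutput W P = QV) (u : U) {v : V} (hv : QV v = 0) : P u * W u v = 0 := by
  rw [← hout] at hv
  exact (sum_eq_zero_iff_of_nonneg fun u _ => mul_nonneg (hP u) ((hW u).1 v)).1 hv u (mem_univ u)

theorem sum_mul_symbolDivergence_nonneg (hW : IsChannel W) (hQV : QV ∈ stdSimplex ℝ V) {P : U → ℝ}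
    (hP : ∀ u, 0 ≤ P u) (hout : inducedOutput W P = QV) :
    0 ≤ ∑ u, P u * symbolDivergence W QV u := by
  refine sum_nonneg fun u _ => ?_
  by_cases hu : P u = 0
  · rw [hu, zero_mul]
  · refine mul_nonneg (hP u) (sum_mul_logb_div_nonneg (fun v hv => ?_) (hW u) hQV)
    exact (mul_eq_zero.1 (mul_eq_zero_of_inducedOutput hW hP hout u hv)).resolve_left hu

/-- The moment of order `s` of the likelihood ratio between the channel and the target. -/
noncomputable def ratioMoment (W : U → V → ℝ) (QV : V → ℝ) (P : U → ℝ) (s : ℝ) : ℝ :=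
  ∑ u, ∑ v, P u * (W u v * (W u v / QV v) ^ s)

theorem ratioMoment_nonneg (hW : IsChannel W) (hQV : QV ∈ stdSimplex ℝ V) {P : U → ℝ}
    (hP : ∀ u, 0 ≤ P u) (s : ℝ) : 0 ≤ ratioMoment W QV P s :=
  sum_nonneg fun u _ => sum_nonneg fun v _ => mul_nonneg (hP u) (mul_nonneg ((hW u).1 v)
    (rpow_nonneg (div_nonneg ((hW u).1 v) (hQV.1 v)) s))

theorem hasDerivAt_ratioMoment (hW : IsChannel W) (hQV : QV ∈ stdSimplex ℝ V) {P : U → ℝ}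
    (hP : ∀ u, 0 ≤ P u) (hout : inducedOutput W P = QV) :
    HasDerivAt (ratioMoment W QV P) (log 2 * ∑ u, P u * symbolDivergence W QV u) 0 := by
  have h : ∀ u v, HasDerivAt (fun s : ℝ => P u * (W u v * (W u v / QV v) ^ s))
      (P u * (W u v * log (W u v / QV v))) 0 := by
    intro u v
    -- Null terms are constant in `s`, which avoids the jump of `0 ^ s` at `s = 0`.
    by_cases hc : P u * W u v = 0
    · simp only [← mul_assoc, hc, zero_mul]
      exact hasDerivAt_const _ _
    · have hQ : QV v ≠ 0 := fun hv => hc (mul_eq_zero_of_inducedOutput hW hP hout u hv)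
      have hr : 0 < W u v / QV v :=
        div_pos (lt_of_le_of_ne ((hW u).1 v) (right_ne_zero_of_mul hc).symm)
          (lt_of_le_of_ne (hQV.1 v) hQ.symm)
      have := ((hasStrictDerivAt_const_rpow hr 0).hasDerivAt.const_mul (W u v)).const_mul (P u)
      simpa using this
  have hs := HasDerivAt.fun_sum fun u (_ : u ∈ (univ : Finset U)) =>
    HasDerivAt.fun_sum fun v (_ : v ∈ (univ : Finset V)) => h u v
  have e : log 2 * ∑ u, P u * symbolDivergence W QV u
      = ∑ u, ∑ v, P u * (W u v * log (W u v / QV v)) := by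
    simp only [symbolDivergence, mul_sum, logb]
    refine sum_congr rfl fun u _ => sum_congr rfl fun v _ => ?_
    have : log 2 ≠ 0 := (log_pos one_lt_two).ne'
    field_simp
  rw [e]
  exact hs

/-- Both sides equal `1` at `s = 0`, and there the right side has the larger derivative. -/
theorem exists_ratioMoment_lt (hW : IsChannel W) (hQV : QV ∈ stdSimplex ℝ V) {P : U → ℝ}
    (hP : P ∈ stdSimplex ℝ U) (hout : inducedOutput W P = QV) {R : ℝ}
    (hR : ∑ u, P u * symbolDivergence W QV u < R) :
    ∃ s, 0 < s ∧ s ≤ 1 ∧ ratioMoment W QV P s < 2 ^ (s * R) := by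
  have h2 : HasDerivAt (fun s : ℝ => (2 : ℝ) ^ (s * R)) (log 2 * R) 0 := by
    have h := ((hasDerivAt_id (0 : ℝ)).mul_const R).const_rpow (a := 2) two_pos
    simpa [mul_comm, mul_left_comm] using h
  have hd := h2.sub (hasDerivAt_ratioMoment hW hQV hP.1 hout)
  have h0 : ratioMoment W QV P 0 = 1 := by
    simp [ratioMoment, ← mul_sum, (hW _).2, hP.2]
  have hpos : 0 < log 2 * R - log 2 * ∑ u, P u * symbolDivergence W QV u := by
    rw [← mul_sub]
    exact mul_pos (log_pos one_lt_two) (sub_pos.2 hR)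
  have hslope := (hasDerivAt_iff_tendsto_slope.1 hd).eventually (lt_mem_nhds hpos)
  have hev : ∀ᶠ s in 𝓝[>] (0 : ℝ), 0 < slope ((fun s : ℝ => (2 : ℝ) ^ (s * R))
      - ratioMoment W QV P) 0 s :=
    hslope.filter_mono (nhdsWithin_mono _ fun s hs => (ne_of_gt hs))
  obtain ⟨s, hs, hs0, hs1⟩ := (hev.and (Ioc_mem_nhdsGT one_pos)).exists
  refine ⟨s, hs0, hs1, ?_⟩
  rw [slope_def_field] at hs
  simp only [Pi.sub_apply, zero_mul, rpow_zero, h0, sub_self, sub_zero] at hs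
  have := (div_pos_iff_of_pos_right hs0).1 hs
  linarith

theorem exists_code_divergence_le (hW : IsChannel W) (hQV : QV ∈ stdSimplex ℝ V) {P : U → ℝ}
    (hP : P ∈ stdSimplex ℝ U) (hout : inducedOutput W P = QV) {s : ℝ} (hs : 0 < s) (hs1 : s ≤ 1)
    {n M : ℕ} (hM : 0 < M) :
    ∃ f : Fin M → Fin n → U, divergence (outputDist W f) (prodDist QV n)
      ≤ ((ratioMoment W QV P s ^ n / (M : ℝ) ^ s / (s * log 2) : ℝ) : EReal) := by
  have hM' : (0 : ℝ) < M := by exact_mod_cast hM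
  set K : (Fin n → U) → (Fin n → V) → ℝ := fun a b => ∏ i, W (a i) (b i) with hKdef
  have hK : ∀ a b, 0 ≤ K a b := fun a b => prod_nonneg fun i _ => (hW _).1 _
  have hPn := prodDist_mem_stdSimplex hP n
  have hT : ∀ b, ∑ a, prodDist P n a * K a b = prodDist QV n b := by
    intro b
    simp only [prodDist, hKdef, ← prod_mul_distrib]
    rw [← Fintype.prod_sum fun i u => P u * W u (b i)]
    exact prod_congr rfl fun i _ => congrFun hout (b i)
  obtain ⟨f, hf, hle⟩ := exists_code_sum_mul_log_le hK hPn hT hM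
  refine ⟨f, ?_⟩
  -- Codewords of positive probability keep the output support inside that of the target, so the
  -- divergence is finite.
  have hac : ∀ x, prodDist QV n x = 0 → outputDist W f x = 0 := by
    intro x hx
    obtain ⟨i, -, hi⟩ := prod_eq_zero_iff.1 hx
    refine sum_eq_zero fun w _ => ?_
    have hw : P (f w i) ≠ 0 := prod_ne_zero_iff.1 (hf w) i (mem_univ i)
    have h0 := mul_eq_zero_of_inducedOutput hW hP.1 hout (f w i) hi
    rw [prod_eq_zero (mem_univ i) ((mul_eq_zero.1 h0).resolve_left hw), mul_zero]
  rw [divergence, if_pos hac, EReal.coe_le_coe_iff, sum_mul_logb_div, ← div_div]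
  refine div_le_div_of_nonneg_right ?_ (log_pos one_lt_two).le
  refine hle.trans ?_
  have hterm : ∀ a b, prodDist P n a * (K a b * log (1 + K a b / (M * prodDist QV n b)))
      ≤ (∏ i, P (a i) * (W (a i) (b i) * (W (a i) (b i) / QV (b i)) ^ s))
        * (1 / (M : ℝ) ^ s / s) := by
    intro a b
    have hr : ∀ i, 0 ≤ W (a i) (b i) / QV (b i) := fun i => div_nonneg ((hW _).1 _) (hQV.1 _)
    have hx : K a b / (M * prodDist QV n b) = (∏ i, W (a i) (b i) / QV (b i)) / M := by
      rw [prod_div_distrib, div_div, mul_comm (M : ℝ)]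
      rfl
    have hlog := log_one_add_le_rpow_div
      (div_nonneg (prod_nonneg fun i (_ : i ∈ univ) => hr i) hM'.le) hs hs1
    rw [div_rpow (prod_nonneg fun i _ => hr i) hM'.le,
      ← finsetProd_rpow _ _ fun i _ => hr i] at hlog
    rw [hx, prod_mul_distrib, prod_mul_distrib]
    calc _ ≤ prodDist P n a * (K a b *
          ((∏ i, (W (a i) (b i) / QV (b i)) ^ s) / (M : ℝ) ^ s / s)) :=
          mul_le_mul_of_nonneg_left (mul_le_mul_of_nonneg_left hlog (hK a b)) (hPn.1 a)
      _ = _ := by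
          simp only [prodDist, hKdef]
          ring
  refine (sum_le_sum fun a _ => sum_le_sum fun b _ => hterm a b).trans (le_of_eq ?_)
  simp only [← sum_mul]
  rw [sum_sum_prod_eq_pow fun u v => P u * (W u v * (W u v / QV v) ^ s)]
  simp only [ratioMoment]
  ring

theorem eventually_approxWithin (hW : IsChannel W) (hQV : QV ∈ stdSimplex ℝ V) {P : U → ℝ}
    (hP : P ∈ stdSimplex ℝ U) (hout : inducedOutput W P = QV) {R : ℝ}
    (hR : ∑ u, P u * symbolDivergence W QV u < R) {ξ : ℝ} (hξ : 0 < ξ) :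
    ∀ᶠ n : ℕ in atTop, ApproxWithin W QV R n ξ := by
  have hR0 : 0 < R := (sum_mul_symbolDivergence_nonneg hW hQV hP.1 hout).trans_lt hR
  obtain ⟨s, hs, hs1, hlt⟩ := exists_ratioMoment_lt hW hQV hP hout hR
  set φ := ratioMoment W QV P s with hφ
  have hφ0 : 0 ≤ φ := ratioMoment_nonneg hW hQV hP.1 s
  have h2s : (0 : ℝ) < 2 ^ (s * R) := by positivity
  have hq : Tendsto (fun n : ℕ => (φ / 2 ^ (s * R)) ^ n * (2 ^ s / (s * log 2))) atTop (𝓝 0) := by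
    have := tendsto_pow_atTop_nhds_zero_of_lt_one (div_nonneg hφ0 h2s.le)
      ((div_lt_one h2s).2 hlt)
    simpa using this.mul_const (2 ^ s / (s * log 2))
  filter_upwards [hq.eventually (gt_mem_nhds hξ)] with n hn
  have h1 : (1 : ℝ) ≤ 2 ^ ((n : ℝ) * R) := one_le_rpow one_le_two (by positivity)
  have hM : 0 < numCodewords R n := Nat.floor_pos.2 h1
  have hM1 : (1 : ℝ) ≤ numCodewords R n := by exact_mod_cast hM
  refine ⟨hM, ?_⟩
  obtain ⟨f, hf⟩ := exists_code_divergence_le hW hQV hP hout hs hs1 (n := n) hM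
  refine ⟨f, hf.trans_lt (EReal.coe_lt_coe_iff.2 (lt_of_le_of_lt ?_ hn))⟩
  -- Since `M ≥ 1`, rounding down loses at most a factor `2`: `2 ^ (nR) < M + 1 ≤ 2 M`.
  have hfl : (2 : ℝ) ^ ((n : ℝ) * R) / 2 ≤ numCodewords R n := by
    have := Nat.lt_floor_add_one ((2 : ℝ) ^ ((n : ℝ) * R))
    change _ < (numCodewords R n : ℝ) + 1 at this
    linarith
  have hMs : (2 ^ (s * R)) ^ n / 2 ^ s ≤ (numCodewords R n : ℝ) ^ s := by
    have := rpow_le_rpow (by positivity) hfl hs.le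
    rwa [div_rpow (by positivity) two_pos.le, ← rpow_mul two_pos.le,
      show (n : ℝ) * R * s = s * R * n by ring, rpow_mul two_pos.le, rpow_natCast] at this
  have hl : 0 < log 2 := log_pos one_lt_two
  calc φ ^ n / (numCodewords R n : ℝ) ^ s / (s * log 2)
      ≤ φ ^ n / ((2 ^ (s * R)) ^ n / 2 ^ s) / (s * log 2) := by
        gcongr
    _ = _ := by
        rw [div_pow]
        field_simp

end Direct

end ProductApprox

theorem theorem1 {U V : Type*} [Fintype U] [Fintype V]
    (W : U → V → ℝ) (hW : ProductApprox.IsChannel W)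
    (QV : V → ℝ) (hQV : QV ∈ stdSimplex ℝ V) (R : ℝ) :
    ((∃ Q : U × V → ℝ, ProductApprox.IsAdmissibleJoint W QV Q ∧ ProductApprox.mutualInfo Q < R) →
      ProductApprox.IsAchievable W QV R ∧
        ∀ ξ : ℝ, 0 < ξ → ∀ᶠ n : ℕ in Filter.atTop, ProductApprox.ApproxWithin W QV R n ξ) ∧
    ((∀ Q : U × V → ℝ, ProductApprox.IsAdmissibleJoint W QV Q → R < ProductApprox.mutualInfo Q) →
      ¬ ProductApprox.IsAchievable W QV R) := by
  refine ⟨?_, ProductApprox.not_isAchievable hW hQV⟩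
  rintro ⟨Q, hQ, hlt⟩
  rw [hQ.mutualInfo_eq] at hlt
  have hev := fun ξ (hξ : 0 < ξ) => ProductApprox.eventually_approxWithin hW hQV
    hQ.marginalU_mem_stdSimplex hQ.inducedOutput_eq hlt hξ
  refine ⟨fun ξ hξ => ?_, hev⟩
  obtain ⟨n, hn, h1⟩ := ((hev ξ hξ).and (Filter.eventually_ge_atTop 1)).exists
  exact ⟨n, h1, hn⟩
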